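/- Let $k$ be an algebraically closed field of characteristic $p>0$; a variety over $k$ means a separated scheme of finite type over $k$. Let $f\colon T\to B$ be a dominant morphism (over $k$) of integral varieties over $k$, and let $K=k(B)$. Assume that the generic fibre $C=T_\eta$ is a regular, geometrically integral curve (i.e. of dimension one) over $K$. For $n\ge 0$ let $C^{(p^n)}$ denote the $n$-th Frobenius pullback of $C$, i.e. the base change of $C\to\operatorname{Spec}K$ along the morphism $\operatorname{Spec}K\to\operatorname{Spec}K$ given by $K\to K$, $c\mapsto c^{p^n}$. Assume that for some $n\ge 0$ the curve $C^{(p^n)}$ is rational over $K$, i.e. birational over $K$ to $\mathbb{P}^1_K$. Then: 1. $T$ is (inseparably) uniruled: there are an integral variety $Y$ over $k$ and a dominant rational map $Y\times_k\mathbb{P}^1_k \dashrightarrow T$ over $k$ whose associated extension of function fields $k(Y\times_k\mathbb{P}^1_k)\,|\,k(T)$ is finite and purely inseparable (possibly trivial); in particular $\dim Y=\dim T-1$. 2. If in addition $B$ is rational over $k$ (birational over $k$ to some $\mathbb{P}^m_k$), then $T$ is (inseparably) unirational: there are an integer $d\ge 0$ and a dominant rational map $\mathbb{P}^d_k\dashrightarrow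 T$ over $k$ whose associated extension of function fields is finite and purely inseparable (possibly trivial); in particular $d=\dim T$. -/

import Mathlib

universe u

open CategoryTheory CategoryTheory.Limits AlgebraicGeometry

namespace FrobeniusFibration

/-- Every residue field of a scheme over a field of characteristic `p` has characteristic `p`. -/
theorem charP_residueField {k : Type u} [Field k] (p : ℕ) [CharP k p] {X : Scheme.{u}}
    (sX : X ⟶ Spec (.of k)) (x : X) : CharP (X.residueField x) p :=
  charP_of_injective_ringHom
    (f := (Spec.preimage (X.fromSpecResidueField x ≫ sX)).hom) (RingHom.injective _) p

/-- The structure morphism `C^(p^n) ⟶ Spec K` of the `n`-th iterated Frobenius pullback of a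
`K`-scheme `C`: the base change of `C ⟶ Spec K` along the morphism `Spec K ⟶ Spec K`
given by the `p^n`-power map of `K`. -/
noncomputable def frobeniusPullback (p n : ℕ) {K : CommRingCat.{u}} [ExpChar K p]
    {C : Scheme.{u}} (sC : C ⟶ Spec K) :
    pullback sC (Spec.map (CommRingCat.ofHom (iterateFrobenius K p n))) ⟶ Spec K :=
  pullback.snd sC (Spec.map (CommRingCat.ofHom (iterateFrobenius K p n)))

/-- A scheme is regular if all its local rings are regular. -/
def IsRegular (X : Scheme.{u}) : Prop :=
  ∀ x : X, IsRegularLocalRing (X.presheaf.stalk x)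

theorem genericPoint_mem_domain {X Y : Scheme.{u}} [IrreducibleSpace X] (f : X.PartialMap Y) :
    genericPoint X ∈ f.domain :=
  (genericPoint_spec X).mem_open_set_iff f.domain.isOpen |>.mpr
    (by simpa using f.dense_domain.nonempty)

/-- The homomorphism induced by a partial map `f : X ⇢ Y` from the local ring of `Y` at the
image of the generic point of `X` to the function field of `X`. For dominant `f` and
integral `Y` the source is the function field of `Y`. -/
noncomputable def functionFieldMap {X Y : Scheme.{u}} [IrreducibleSpace X] (f : X.PartialMap Y) :
    Y.presheaf.stalk (f.hom ⟨genericPoint X, genericPoint_mem_domain f⟩) ⟶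
      f.domain.toScheme.presheaf.stalk ⟨genericPoint X, genericPoint_mem_domain f⟩ :=
  f.hom.stalkMap ⟨genericPoint X, genericPoint_mem_domain f⟩

/-- A ring homomorphism (in practice of fields) that makes its target a finite purely inseparable
extension of its source. -/
def IsFinitePurelyInseparable {F E : Type u} [CommRing F] [CommRing E] (φ : F →+* E) : Prop :=
  φ.Finite ∧ letI := φ.toAlgebra; IsPurelyInseparable F E

/-- Let `X` and `Y` be schemes over `S` with `X` irreducible. There is a dominant rational map
`X ⇢ Y` over `S`, generically finite and purely inseparable, i.e. the extension of
function fields is finite and purely inseparable (possibly trivial). -/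
def PurelyInseparablyDominates {S X Y : Scheme.{u}} [IrreducibleSpace X]
    (sX : X ⟶ S) (sY : Y ⟶ S) : Prop :=
  ∃ f : X.PartialMap Y, IsDominant f.hom ∧ f.hom ≫ sY = f.domain.ι ≫ sX ∧
    IsFinitePurelyInseparable (functionFieldMap f).hom

/-- The variety `T` over `k` is (inseparably) uniruled: there are an integral variety `Y` over `k`
and a dominant, generically finite, purely inseparable rational map over `k` from `Y × ℙ¹`
to `T` (so `dim Y = dim T - 1`). As `Y × 𝔸¹` is a dense open subscheme of `Y × ℙ¹`, the two
have the same rational maps, and we use `Y × 𝔸¹`. -/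
def IsInseparablyUniruled {k : Type u} [Field k] {T : Scheme.{u}}
    (sT : T ⟶ Spec (.of k)) : Prop :=
  ∃ (Y : Scheme.{u}) (sY : Y ⟶ Spec (.of k)) (_ : IsIntegral Y),
    IsSeparated sY ∧ LocallyOfFiniteType sY ∧ QuasiCompact sY ∧
      PurelyInseparablyDominates ((𝔸(PUnit.{u + 1}; Y) ↘ Y) ≫ sY) sT

/-- The variety `T` over `k` is (inseparably) unirational: there is a dominant, generically finite,
purely inseparable rational map over `k` from a finite-dimensional affine (equivalently,
projective) space over `k` to `T`. -/
def IsInseparablyUnirational {k : Type u} [Field k] {T : Scheme.{u}}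
    (sT : T ⟶ Spec (.of k)) : Prop :=
  ∃ (ι : Type u) (_ : Finite ι),
    PurelyInseparablyDominates (𝔸(ι; Spec (.of k)) ↘ Spec (.of k)) sT

end FrobeniusFibration

namespace FrobeniusFibration

/-! Write `C'` for the Frobenius pullback of the generic fibre `C`, with its projection `C' ⟶ C ⟶
T`. Composing this projection to `C` with the relative Frobenius `C ⟶ C'` gives the absolute
Frobenius of `C'`, so the function field `E` of `C'` satisfies `E ^ (p ^ n) ⊆ k(T)`. As `E` is
finitely generated over `k(T)`, it is finite and purely inseparable (`pow_mem_range_of_isPullback`,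
`isFinitePurelyInseparable_of_pow_mem`). Rationality of `C'` over `K = k(B)` identifies `E` with the
function field of an affine space over `B`, which therefore dominates `T`.

The projection `C' ⟶ T` lies over the Frobenius of `k`, so the affine space must carry a
Frobenius-twisted structure morphism to `Spec k` (`purelyInseparablyDominates_of_birationalOver`).
It is still a variety because `k` is perfect. Splitting off one coordinate gives uniruledness; if
`B` is rational, the twist is undone by an automorphism of the scheme `𝔸(m ⊕ N; Spec k)`. -/

/-- The iterated Frobenius endomorphism of the spectrum of a ring of characteristic `p`. -/
noncomputable abbrev specFrobenius (p n : ℕ) (R : CommRingCat.{u}) [ExpChar R p] :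
    Spec R ⟶ Spec R :=
  Spec.map (CommRingCat.ofHom (iterateFrobenius R p n))

theorem specFrobenius_comm (p n : ℕ) {R S : CommRingCat.{u}} [ExpChar R p] [ExpChar S p]
    (g : Spec S ⟶ Spec R) : specFrobenius p n S ≫ g = g ≫ specFrobenius p n R := by
  obtain ⟨ψ, rfl⟩ := Spec.map_surjective g
  rw [← Spec.map_comp, ← Spec.map_comp]
  congr 1
  ext x
  exact (RingHom.map_iterateFrobenius ψ.hom p x n).symm

/-! ### Points with values in local rings and fields -/

theorem exists_factor_fromSpecStalk {R : CommRingCat.{u}} [IsLocalRing R] {X : Scheme.{u}}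
    (f : Spec R ⟶ X) {x : X} (hx : f (IsLocalRing.closedPoint R) = x) :
    ∃ γ : X.presheaf.stalk x ⟶ R, Spec.map γ ≫ X.fromSpecStalk x = f := by
  subst hx
  exact ⟨Scheme.stalkClosedPointTo f, Scheme.Spec_stalkClosedPointTo_fromSpecStalk f⟩

theorem exists_factor_fromSpecResidueField {R : CommRingCat.{u}} (hR : IsField R)
    {X : Scheme.{u}} (f : Spec R ⟶ X) {x : X} (y : Spec R) (hx : f y = x) :
    ∃ g : Spec R ⟶ Spec (X.residueField x), g ≫ X.fromSpecResidueField x = f := by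
  let := hR.toField
  obtain rfl : y = IsLocalRing.closedPoint R := Subsingleton.elim (α := PrimeSpectrum R) _ _
  subst hx
  exact ⟨_, Scheme.descResidueField_stalkClosedPointTo_fromSpecResidueField R X f⟩

/-- A morphism from the spectrum of a local ring that is surjective on stalks is induced by a
surjection from the local ring at the image of the closed point. -/
theorem exists_surjective_factor_fromSpecStalk {R : CommRingCat.{u}} [IsLocalRing R]
    {X : Scheme.{u}} (f : Spec R ⟶ X) [SurjectiveOnStalks f] {x : X}
    (hx : f (IsLocalRing.closedPoint R) = x) :
    ∃ γ : X.presheaf.stalk x ⟶ R, Spec.map γ ≫ X.fromSpecStalk x = f ∧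
      Function.Surjective γ := by
  subst hx
  refine ⟨Scheme.stalkClosedPointTo f, Scheme.Spec_stalkClosedPointTo_fromSpecStalk f, ?_⟩
  have h := f.stalkMap_surjective (IsLocalRing.closedPoint R)
  exact (ConcreteCategory.bijective_of_isIso (stalkClosedPointIso R).hom).2.comp h

/-! ### Relative Frobenius and pure inseparability -/

/-- Let `C'` be the pullback of `f : T ⟶ B` along the composite of the Frobenius of `Spec K` and
a monomorphism `i : Spec K ⟶ B`. Given a field-valued point `g` of `C'` that is surjective on
stalks and whose image in `T` factors through `τ : Spec F ⟶ T`, the `p^n`-th powers of `E` come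
from `F`. -/
theorem pow_mem_range_of_isPullback (p n : ℕ) {K E F : CommRingCat.{u}}
    [ExpChar K p] [ExpChar E p] [ExpChar F p] (hE : IsField E) (hF : IsField F)
    {T B C' : Scheme.{u}} {f : T ⟶ B} {i : Spec K ⟶ B} [Mono i]
    {a : C' ⟶ T} {b : C' ⟶ Spec K} (h : IsPullback a b f (specFrobenius p n K ≫ i))
    (g : Spec E ⟶ C') [SurjectiveOnStalks g] (ψ : F ⟶ E) (τ : Spec F ⟶ T)
    (hτ : Spec.map ψ ≫ τ = g ≫ a) (l : Spec F ⟶ Spec K) (hl : l ≫ i = τ ≫ f) (x : E) :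
    x ^ p ^ n ∈ ψ.hom.range := by
  let := hE.toField
  let := hF.toField
  -- The relative Frobenius, evaluated at the point `τ` of `T`.
  let c : Spec F ⟶ C' := h.lift (specFrobenius p n F ≫ τ) l (by
    rw [Category.assoc, ← hl, ← Category.assoc, specFrobenius_comm, Category.assoc])
  have hc : Spec.map ψ ≫ c = specFrobenius p n E ≫ g := by
    apply h.hom_ext
    · rw [Category.assoc, Category.assoc, IsPullback.lift_fst, ← hτ, ← Category.assoc,
        ← specFrobenius_comm, Category.assoc]
    · rw [Category.assoc, Category.assoc, IsPullback.lift_snd, specFrobenius_comm,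
        ← cancel_mono i, Category.assoc, hl, ← Category.assoc, hτ, Category.assoc, h.w]
      simp only [Category.assoc]
  obtain ⟨γ, hγ, hγs⟩ := exists_surjective_factor_fromSpecStalk g rfl
  have hcg : c (IsLocalRing.closedPoint F) = g (IsLocalRing.closedPoint E) := by
    have h1 (z : Spec E) : c (Spec.map ψ z) = g (specFrobenius p n E z) := by
      rw [← Scheme.Hom.comp_apply, hc, Scheme.Hom.comp_apply]
    convert h1 (IsLocalRing.closedPoint E) using 2
    · exact congrArg c (Subsingleton.elim (α := PrimeSpectrum F) _ _)
    · exact congrArg g (Subsingleton.elim (α := PrimeSpectrum E) _ _)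
  obtain ⟨ζ, hζ⟩ := exists_factor_fromSpecStalk c hcg
  have hcomp : ζ ≫ ψ = γ ≫ CommRingCat.ofHom (iterateFrobenius E p n) := by
    apply Spec.map_injective
    rw [← cancel_mono (C'.fromSpecStalk _), Spec.map_comp, Spec.map_comp, Category.assoc,
      Category.assoc, hζ, hγ, hc]
  -- Surjectivity of `γ` makes every `x ^ p ^ n` equal to `ψ (ζ y)` for some `y`.
  obtain ⟨y, rfl⟩ := hγs x
  exact ⟨ζ y, congrArg (fun φ ↦ φ.hom y) hcomp⟩

/-- The power condition makes the extension algebraic; finiteness then follows because essentially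
finite type means finitely generated as a field extension. -/
theorem isFinitePurelyInseparable_of_pow_mem (p n : ℕ) {F E : Type u} [CommRing F] [CommRing E]
    [ExpChar F p] (hF : IsField F) (hE : IsField E) (ψ : F →+* E) (hψ : ψ.EssFiniteType)
    (h : ∀ x : E, x ^ p ^ n ∈ ψ.range) : IsFinitePurelyInseparable ψ := by
  let := hF.toField
  let := hE.toField
  let := ψ.toAlgebra
  have : Algebra.EssFiniteType F E := hψ
  have hpi : IsPurelyInseparable F E :=
    (isPurelyInseparable_iff_pow_mem F p).mpr fun x ↦ ⟨n, h x⟩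
  obtain ⟨s, hs⟩ := IntermediateField.fg_top F E
  have hfin : Module.Finite F E := by
    have := IntermediateField.finiteDimensional_adjoin (K := F) (S := (s : Set E))
      fun x _ ↦ Algebra.IsIntegral.isIntegral x
    rw [hs] at this
    exact Module.Finite.equiv IntermediateField.topEquiv.toLinearEquiv
  exact ⟨hfin, hpi⟩

/-! ### Generic points as points with dense image -/

theorem eq_genericPoint_of_dense_singleton {X : Scheme.{u}} [IrreducibleSpace X] {x : X}
    (hx : Dense {x}) : x = genericPoint X :=
  IsGenericPoint.eq (S := Set.univ) hx.closure_eq (genericPoint_spec X)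

theorem isField_stalk_of_dense_singleton {X : Scheme.{u}} [IsIntegral X] {x : X}
    (hx : Dense {x}) : IsField (X.presheaf.stalk x) := by
  rw [eq_genericPoint_of_dense_singleton hx]
  exact Field.toIsField X.functionField

theorem dense_singleton_of_isPreimmersion {X Y : Scheme.{u}} (f : X ⟶ Y) [IsPreimmersion f]
    {x : X} (hx : Dense {f x}) : Dense {x} := by
  rw [f.isEmbedding.isInducing.dense_iff]
  intro z
  rw [Set.image_singleton]
  exact hx _

theorem expChar_of_hom {k : Type u} [Field k] (p : ℕ) [ExpChar k p] {R : CommRingCat.{u}}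
    [Nontrivial R] (g : Spec R ⟶ Spec (.of k)) : ExpChar R p :=
  expChar_of_injective_ringHom (Spec.preimage g).hom.injective p

theorem dense_singleton_map {X Y : Scheme.{u}} (f : X ⟶ Y) [IsDominant f]
    {x : X} (hx : Dense {x}) : Dense {f x} := by
  simpa using f.denseRange.dense_image f.continuous hx

theorem isDominant_of_isOpenImmersion {X Y : Scheme.{u}} (f : X ⟶ Y) [IsOpenImmersion f]
    [Nonempty X] [IrreducibleSpace Y] : IsDominant f :=
  ⟨f.isOpenEmbedding.isOpen_range.dense (Set.range_nonempty _)⟩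

/-- A field-valued point with dense image factors through every nonempty open immersion. -/
theorem exists_lift_of_isOpenImmersion {R : CommRingCat.{u}} (hR : IsField R) {U X : Scheme.{u}}
    (i : U ⟶ X) [IsOpenImmersion i] [Nonempty U] (f : Spec R ⟶ X) (z : Spec R)
    (hz : Dense {f z}) : ∃ g : Spec R ⟶ U, g ≫ i = f := by
  let := hR.toField
  refine ⟨IsOpenImmersion.lift i f ?_, IsOpenImmersion.lift_fac i f _⟩
  rintro _ ⟨w, rfl⟩
  obtain rfl : w = z := Subsingleton.elim (α := PrimeSpectrum R) _ _
  obtain ⟨_, h, rfl⟩ := hz.inter_open_nonempty _ i.isOpenEmbedding.isOpen_range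
    (Set.range_nonempty _)
  exact h

/-! ### Dominant rational maps from generic points -/

/-- A criterion for the existence of a dominant, generically finite and purely inseparable
rational map in terms of the generic point of the source. -/
theorem purelyInseparablyDominates_of_point {k : Type u} [Field k] (p n : ℕ) [ExpChar k p]
    {X T : Scheme.{u}} [IsIntegral X] [IsIntegral T] (sX : X ⟶ Spec (.of k))
    (sT : T ⟶ Spec (.of k)) [LocallyOfFiniteType sX] [LocallyOfFiniteType sT]
    (q : Spec X.functionField ⟶ T) (h : q ≫ sT = X.fromSpecStalk _ ≫ sX)
    (z : Spec X.functionField) (hq : Dense {q z})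
    (hpow : ∀ (y : T), Dense {y} → ∀ γ : T.presheaf.stalk y ⟶ X.functionField,
      Spec.map γ ≫ T.fromSpecStalk y = q → ∀ x : X.functionField, x ^ p ^ n ∈ γ.hom.range) :
    PurelyInseparablyDominates sX sT := by
  -- Since `T` is locally of finite type over `k`, the point `q` spreads out to an open
  -- neighbourhood of the generic point of `X`.
  let P := Scheme.PartialMap.ofFromSpecStalk sX sT q h
  have hP : P.hom ≫ sT = P.domain.ι ≫ sX := Scheme.PartialMap.ofFromSpecStalk_comp sX sT q h
  have hPq : P.domain.fromSpecStalkOfMem _ (genericPoint_mem_domain P) ≫ P.hom = q :=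
    Scheme.PartialMap.fromSpecStalkOfMem_ofFromSpecStalk sX sT q h
  let x₀ : P.domain.toScheme := ⟨genericPoint X, genericPoint_mem_domain P⟩
  let e := P.domain.ι.stalkMap x₀
  have hz : X.fromSpecStalk (genericPoint X) z = genericPoint X := by
    obtain rfl : z = IsLocalRing.closedPoint X.functionField :=
      Subsingleton.elim (α := PrimeSpectrum X.functionField) _ _
    exact Scheme.fromSpecStalk_closedPoint
  have hx₀ : P.domain.fromSpecStalkOfMem _ (genericPoint_mem_domain P) z = x₀ := by
    apply P.domain.ι.injective
    rw [← Scheme.Hom.comp_apply, Scheme.Opens.fromSpecStalkOfMem_ι, hz]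
    rfl
  have hdense : Dense {P.hom x₀} := by
    rwa [← hx₀, ← Scheme.Hom.comp_apply, hPq]
  have hE : IsField (P.domain.toScheme.presheaf.stalk x₀) :=
    (asIso e).commRingCatIsoToRingEquiv.symm.toMulEquiv.isField
      (Field.toIsField X.functionField)
  have hF := isField_stalk_of_dense_singleton hdense
  have hdom : IsDominant P.hom := ⟨hdense.mono (by simp)⟩
  have : LocallyOfFiniteType P.hom := by
    have : LocallyOfFiniteType (P.hom ≫ sT) := hP ▸ inferInstance
    exact locallyOfFiniteType_of_comp P.hom sT
  have hγ : Spec.map (P.hom.stalkMap x₀ ≫ inv e) ≫ T.fromSpecStalk _ = q := by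
    rw [Spec.map_comp, Category.assoc, Scheme.SpecMap_stalkMap_fromSpecStalk, ← hPq,
      Scheme.Opens.fromSpecStalkOfMem, Category.assoc]
    rfl
  refine ⟨P, hdom, hP, ?_⟩
  have := hF.nontrivial
  have : ExpChar (T.presheaf.stalk (P.hom x₀)) p := expChar_of_hom p (T.fromSpecStalk _ ≫ sT)
  refine isFinitePurelyInseparable_of_pow_mem p n hF hE _
    (LocallyOfFiniteType.stalkMap P.hom x₀) fun x ↦ ?_
  obtain ⟨z, rfl⟩ := (ConcreteCategory.bijective_of_isIso e).2 x
  obtain ⟨w, hw⟩ := hpow _ hdense _ hγ z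
  refine ⟨w, ?_⟩
  calc P.hom.stalkMap x₀ w = e ((P.hom.stalkMap x₀ ≫ inv e) w) := by
        rw [← CommRingCat.comp_apply, Category.assoc, IsIso.inv_hom_id, Category.comp_id]
    _ = e z ^ p ^ n := (congrArg e hw).trans (map_pow e.hom z _)

/-- Suppose that the Frobenius pullback `C'` of the generic fibre of `f : T ⟶ B` is birational to
an affine space. Then every variety birational to the corresponding affine space over `B`, with
the structure morphism to `Spec k` twisted by Frobenius, dominates `T` purely inseparably. -/
theorem purelyInseparablyDominates_of_birationalOver {k : Type u} [Field k] (p n : ℕ)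
    [ExpChar k p] {T B : Scheme.{u}} (sT : T ⟶ Spec (.of k)) (sB : B ⟶ Spec (.of k))
    [IsIntegral T] [LocallyOfFiniteType sT] [IsIntegral B]
    (f : T ⟶ B) (hf : f ≫ sB = sT) [ExpChar (B.residueField (genericPoint B)) p]
    {C' : Scheme.{u}} {a : C' ⟶ T} {b : C' ⟶ Spec (B.residueField (genericPoint B))}
    [IsDominant a] [IsDominant f]
    (hC : IsPullback a b f (specFrobenius p n _ ≫ B.fromSpecResidueField (genericPoint B)))
    (N : Type u) (hN : Scheme.BirationalOver b (𝔸(N; Spec (B.residueField (genericPoint B))) ↘ _))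
    {X O : Scheme.{u}} [IsIntegral X] [Nonempty O] (sX : X ⟶ Spec (.of k)) [LocallyOfFiniteType sX]
    (o : O ⟶ X) (e : O ⟶ 𝔸(N; B)) [IsOpenImmersion o] [IsOpenImmersion e]
    (h : e ≫ (𝔸(N; B) ↘ B) ≫ sB ≫ specFrobenius p n (.of k) = o ≫ sX) :
    PurelyInseparablyDominates sX sT := by
  have hE : IsField X.functionField := Field.toIsField X.functionField
  let pt : Spec X.functionField := IsLocalRing.closedPoint X.functionField
  have hpt : X.fromSpecStalk (genericPoint X) pt = genericPoint X :=
    Scheme.fromSpecStalk_closedPoint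
  have hX : Dense {X.fromSpecStalk (genericPoint X) pt} := by
    rw [hpt]
    exact dense_iff_closure_eq.mpr (genericPoint_spec X)
  obtain ⟨r, hr⟩ := exists_lift_of_isOpenImmersion hE o _ pt hX
  -- The preimmersion property is carried through each lift so that the final point `g` of `C'` is
  -- surjective on stalks.
  have : IsPreimmersion (r ≫ o) := hr ▸ inferInstance
  have : IsPreimmersion r := .of_comp r o
  have := isDominant_of_isOpenImmersion e
  have hrd : Dense {r pt} := dense_singleton_of_isPreimmersion o
    (by rwa [← Scheme.Hom.comp_apply, hr])
  have hjd : Dense {(r ≫ e) pt} := by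
    rw [Scheme.Hom.comp_apply]
    exact dense_singleton_map e hrd
  have hjB : ((r ≫ e) ≫ 𝔸(N; B) ↘ B) pt = genericPoint B := by
    rw [Scheme.Hom.comp_apply]
    exact eq_genericPoint_of_dense_singleton (dense_singleton_map _ hjd)
  obtain ⟨l, hl⟩ := exists_factor_fromSpecResidueField hE _ pt hjB
  have hA := AffineSpace.isPullback_map (n := N) (B.fromSpecResidueField (genericPoint B))
  have : IsPreimmersion (AffineSpace.map N (B.fromSpecResidueField (genericPoint B))) :=
    MorphismProperty.of_isPullback hA.flip inferInstance
  -- The generic point of `X`, seen in the generic fibre of `𝔸(N; B)` over `B`.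
  let j := hA.lift (r ≫ e) l hl.symm
  have hj : j ≫ AffineSpace.map N _ = r ≫ e := hA.lift_fst _ _ _
  have : IsPreimmersion (j ≫ AffineSpace.map N (B.fromSpecResidueField (genericPoint B))) :=
    hj ▸ inferInstance
  have : IsPreimmersion j := .of_comp j (AffineSpace.map N (B.fromSpecResidueField _))
  have hjd' : Dense {j pt} := dense_singleton_of_isPreimmersion (AffineSpace.map N _)
    (by rwa [← Scheme.Hom.comp_apply, hj])
  obtain ⟨π, hπ⟩ := hN
  have : Nonempty π.target.toScheme := π.dense_target.nonempty.to_subtype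
  obtain ⟨v, hv⟩ := exists_lift_of_isOpenImmersion hE π.target.ι j pt hjd'
  have : IsPreimmersion (v ≫ π.target.ι) := hv ▸ inferInstance
  have : IsPreimmersion v := .of_comp v π.target.ι
  have hvd : Dense {v pt} := dense_singleton_of_isPreimmersion π.target.ι
    (by rwa [← Scheme.Hom.comp_apply, hv])
  have := Opens.isDominant_ι π.dense_source
  let g : Spec X.functionField ⟶ C' := v ≫ π.iso.inv ≫ π.source.ι
  have hgd : Dense {(g ≫ a) pt} := by
    rw [Scheme.Hom.comp_apply, Scheme.Hom.comp_apply]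
    exact dense_singleton_map a (dense_singleton_map _ hvd)
  have hgb : g ≫ b = l := by
    have hπ' := hπ.symm
    dsimp only [Scheme.PartialIso.IsOver, Scheme.PartialIso.symm, Iso.symm_hom] at hπ'
    dsimp only [g]
    rw [Category.assoc, Category.assoc, hπ', ← Category.assoc, hv]
    exact hA.lift_snd _ _ _
  -- Frobenius on `K` moves to Frobenius on `k`: this is the source of the twist in `h`.
  have hfrob : specFrobenius p n _ ≫ B.fromSpecResidueField (genericPoint B) ≫ sB =
      B.fromSpecResidueField (genericPoint B) ≫ sB ≫ specFrobenius p n (.of k) := by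
    rw [specFrobenius_comm, Category.assoc]
  have : ExpChar X.functionField p := expChar_of_hom p (X.fromSpecStalk _ ≫ sX)
  refine purelyInseparablyDominates_of_point p n sX sT (g ≫ a) ?_ pt hgd fun y hy γ hγ ↦ ?_
  · rw [← hf, Category.assoc, ← Category.assoc a, hC.w]
    simp only [Category.assoc]
    rw [hfrob, ← Category.assoc g, hgb, ← Category.assoc l, hl, ← hr]
    simp only [Category.assoc]
    rw [h]
  · have hF := isField_stalk_of_dense_singleton hy
    have := hF.nontrivial
    have : ExpChar (T.presheaf.stalk y) p := expChar_of_hom p (T.fromSpecStalk _ ≫ sT)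
    let z : Spec (T.presheaf.stalk y) := IsLocalRing.closedPoint (T.presheaf.stalk y)
    have hz : T.fromSpecStalk y z = y := Scheme.fromSpecStalk_closedPoint
    have hz' : (T.fromSpecStalk y ≫ f) z = genericPoint B := by
      rw [Scheme.Hom.comp_apply, hz]
      exact eq_genericPoint_of_dense_singleton (dense_singleton_map f hy)
    obtain ⟨l', hl'⟩ := exists_factor_fromSpecResidueField hF _ z hz'
    exact pow_mem_range_of_isPullback p n hE hF hC g γ (T.fromSpecStalk y) hγ l' hl'

/-! ### Affine spaces: coordinates and dimension -/

/-- An affine space over an affine space is an affine space. -/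
noncomputable def affineSpaceSumIso (m N : Type u) (S : Scheme.{u}) :
    𝔸(N; 𝔸(m; S)) ≅ 𝔸(m ⊕ N; S) where
  hom := AffineSpace.homOfVector ((𝔸(N; 𝔸(m; S)) ↘ 𝔸(m; S)) ≫ (𝔸(m; S) ↘ S))
    (Sum.elim (fun i ↦ (𝔸(N; 𝔸(m; S)) ↘ 𝔸(m; S)).appTop (AffineSpace.coord S i))
      (AffineSpace.coord 𝔸(m; S)))
  inv := AffineSpace.homOfVector (AffineSpace.reindex Sum.inl S)
    (fun j ↦ AffineSpace.coord S (Sum.inr j))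
  hom_inv_id := by
    apply AffineSpace.hom_ext
    · rw [Category.assoc, AffineSpace.homOfVector_over, Category.id_comp]
      apply AffineSpace.hom_ext
      · simp
      · intro i
        rw [Scheme.Hom.comp_appTop, CommRingCat.comp_apply, AffineSpace.reindex_appTop_coord,
          AffineSpace.homOfVector_appTop_coord]
        rfl
    · intro i
      rw [Scheme.Hom.comp_appTop, CommRingCat.comp_apply, AffineSpace.homOfVector_appTop_coord,
        AffineSpace.homOfVector_appTop_coord]
      simp
  inv_hom_id := by
    apply AffineSpace.hom_ext
    · rw [Category.assoc, AffineSpace.homOfVector_over, AffineSpace.homOfVector_over_assoc,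
        AffineSpace.reindex_over, Category.id_comp]
    · rintro (i | i)
      · rw [Scheme.Hom.comp_appTop, CommRingCat.comp_apply, AffineSpace.homOfVector_appTop_coord,
          Sum.elim_inl, ← CommRingCat.comp_apply, ← Scheme.Hom.comp_appTop,
          AffineSpace.homOfVector_over, AffineSpace.reindex_appTop_coord]
        simp
      · rw [Scheme.Hom.comp_appTop, CommRingCat.comp_apply, AffineSpace.homOfVector_appTop_coord,
          Sum.elim_inr, AffineSpace.homOfVector_appTop_coord]
        simp

theorem affineSpaceSumIso_hom_over (m N : Type u) (S : Scheme.{u}) :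
    (affineSpaceSumIso m N S).hom ≫ (𝔸(m ⊕ N; S) ↘ S) =
      (𝔸(N; 𝔸(m; S)) ↘ 𝔸(m; S)) ≫ (𝔸(m; S) ↘ S) :=
  AffineSpace.homOfVector_over _ _

theorem isIso_reindex {m N : Type u} (ε : m ≃ N) (S : Scheme.{u}) :
    IsIso (AffineSpace.reindex ε S) := by
  refine ⟨AffineSpace.reindex ε.symm S, ?_, ?_⟩
  · rw [← AffineSpace.reindex_id]
    exact (AffineSpace.reindex_comp (↾ε.symm) (↾ε) S).symm.trans (by congr 1; ext; simp)
  · rw [← AffineSpace.reindex_id]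
    exact (AffineSpace.reindex_comp (↾ε) (↾ε.symm) S).symm.trans (by congr 1; ext; simp)

theorem isOpenImmersion_affineSpaceMap (N : Type u) {S S' : Scheme.{u}} (f : S ⟶ S')
    [IsOpenImmersion f] : IsOpenImmersion (AffineSpace.map N f) :=
  MorphismProperty.of_isPullback (AffineSpace.isPullback_map f).flip ‹_›

/-- An affine space birational to a scheme locally of finite type over a field is
finite-dimensional. -/
theorem finite_of_birationalOver_affineSpace {K : Type u} [Field K] {X : Scheme.{u}}
    (sX : X ⟶ Spec (.of K)) [LocallyOfFiniteType sX] {N : Type u}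
    (h : Scheme.BirationalOver sX (𝔸(N; Spec (.of K)) ↘ Spec (.of K))) : Finite N := by
  obtain ⟨π, hπ⟩ := h.symm
  let ε := AffineSpace.SpecIso N (.of K)
  have : LocallyOfFiniteType (π.source.ι ≫ (𝔸(N; Spec (.of K)) ↘ Spec (.of K))) := by
    rw [← show _ = _ from hπ]
    infer_instance
  obtain ⟨x, hx⟩ := π.dense_source.nonempty
  obtain ⟨y, rfl⟩ : ∃ y, ε.inv y = x := ε.inv.surjective x
  obtain ⟨_, ⟨_, ⟨g, rfl⟩, rfl⟩, hyg, hg⟩ :=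
    PrimeSpectrum.isBasis_basic_opens.exists_subset_of_mem_open
      (show y ∈ ε.inv ⁻¹ᵁ π.source from hx) (ε.inv ⁻¹ᵁ π.source).isOpen
  have hg0 : g ≠ 0 := by
    rintro rfl
    exact (PrimeSpectrum.mem_basicOpen _ _).mp hyg (Ideal.zero_mem _)
  let L := Localization.Away g
  let i : Spec (.of L) ⟶ Spec (.of (MvPolynomial N K)) :=
    Spec.map (CommRingCat.ofHom (algebraMap _ L))
  have hi : IsOpenImmersion i := IsOpenImmersion.of_isLocalization g
  let c : Spec (.of L) ⟶ π.source.toScheme := IsOpenImmersion.lift π.source.ι (i ≫ ε.inv) (by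
    rintro _ ⟨w, rfl⟩
    have hw : PrimeSpectrum.comap (algebraMap _ L) w ∈ PrimeSpectrum.basicOpen g := by
      rw [← SetLike.mem_coe, ← PrimeSpectrum.localization_away_comap_range L g]
      exact ⟨w, rfl⟩
    rw [Scheme.Opens.range_ι]
    exact hg hw)
  have hc : c ≫ π.source.ι = i ≫ ε.inv := IsOpenImmersion.lift_fac _ _ _
  have : IsOpenImmersion (c ≫ π.source.ι) := hc ▸ inferInstance
  have : IsOpenImmersion c := .of_comp c π.source.ι
  have hcK : c ≫ π.source.ι ≫ (𝔸(N; Spec (.of K)) ↘ Spec (.of K)) =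
      Spec.map (CommRingCat.ofHom (algebraMap K L)) := by
    rw [← Category.assoc, hc, Category.assoc, AffineSpace.SpecIso_inv_over, ← Spec.map_comp]
    rfl
  have hft : LocallyOfFiniteType (Spec.map (CommRingCat.ofHom (algebraMap K L))) :=
    hcK ▸ inferInstance
  rw [HasRingHomProperty.Spec_iff (P := @LocallyOfFiniteType)] at hft
  have : Algebra.FiniteType K L := RingHom.finiteType_algebraMap.mp hft
  -- The localized polynomial ring is of finite type over `K`, yet its transcendence degree is at
  -- least the cardinality of `N`.
  have hlt := trdeg_lt_aleph0_of_finiteType (R := K) (S := L)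
  have hle := trdeg_le_of_injective (IsScalarTower.toAlgHom K (MvPolynomial N K) L)
    (IsLocalization.injective L (powers_le_nonZeroDivisors_of_noZeroDivisors hg0))
  rw [MvPolynomial.trdeg_of_isDomain, Cardinal.lift_id] at hle
  exact Cardinal.lt_aleph0_iff_finite.mp (hle.trans_lt hlt)

/-- A separated scheme over a field that is birational to the zero-dimensional affine space is a
point. -/
theorem subsingleton_of_birationalOver_affineSpace {K : CommRingCat.{u}} (hK : IsField K)
    {X : Scheme.{u}} (sX : X ⟶ Spec K) [IsSeparated sX] {N : Type u} [IsEmpty N]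
    (h : Scheme.BirationalOver sX (𝔸(N; Spec K) ↘ Spec K)) : Subsingleton X := by
  let := hK.toField
  have hs : Subsingleton (Spec K) := inferInstanceAs (Subsingleton (PrimeSpectrum K))
  obtain ⟨π, hπ⟩ := h.symm
  let t := π.source.ι ≫ (𝔸(N; Spec K) ↘ Spec K)
  have : Nonempty π.source.toScheme := π.dense_source.nonempty.to_subtype
  have : Surjective t := ⟨Function.surjective_to_subsingleton _⟩
  have : IsIso t := (isIso_iff_isOpenImmersion_and_surjective t).mpr ⟨inferInstance, ‹_›⟩
  -- A section of a separated morphism is a closed immersion; this one is also dominant, hence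
  -- surjective.
  let s : Spec K ⟶ X := inv t ≫ π.iso.hom ≫ π.target.ι
  have hst : s ≫ sX = 𝟙 _ := by
    dsimp only [s]
    rw [Category.assoc, Category.assoc, show _ = _ from hπ, IsIso.inv_hom_id]
  have := Opens.isDominant_ι π.dense_target
  have hd : IsDominant s := inferInstance
  have : IsClosedImmersion (s ≫ sX) := hst ▸ inferInstance
  have : IsClosedImmersion s := .of_comp s sX
  have hsurj : Function.Surjective s := by
    rw [← Set.range_eq_univ, ← s.isClosedEmbedding.isClosed_range.closure_eq]
    exact s.denseRange.closure_range
  exact hsurj.subsingleton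

theorem topologicalKrullDim_le_zero_of_subsingleton (X : Type*) [TopologicalSpace X]
    [Subsingleton X] : topologicalKrullDim X ≤ 0 := by
  have : DiscreteTopology X := inferInstance
  exact topologicalKrullDim_zero_of_discreteTopology X

/-- The generic point of `T` maps to that of `B`, so it lies in the generic fibre. -/
theorem isDominant_fiberι_genericPoint {T B : Scheme.{u}} [IsIntegral T] [IsIntegral B]
    (f : T ⟶ B) [IsDominant f] : IsDominant (f.fiberι (genericPoint B)) := by
  have hT : Dense {genericPoint T} := dense_iff_closure_eq.mpr (genericPoint_spec T)
  refine ⟨hT.mono ?_⟩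
  rw [f.range_fiberι, Set.singleton_subset_iff]
  exact eq_genericPoint_of_dense_singleton (dense_singleton_map f hT)

theorem isIso_specFrobenius {k : Type u} [Field k] [IsAlgClosed k] (p n : ℕ) [Fact p.Prime]
    [CharP k p] : IsIso (specFrobenius p n (.of k)) := by
  have : IsIso (CommRingCat.ofHom (iterateFrobenius k p n)) :=
    (ConcreteCategory.isIso_iff_bijective _).mpr (bijective_iterateFrobenius k p n)
  infer_instance

end FrobeniusFibration

/-! ### Uniruledness and unirationality -/

open FrobeniusFibration

theorem proposition4p2 {k : Type u} [Field k] [IsAlgClosed k] (p : ℕ) [Fact p.Prime] [CharP k p]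
    {T B : Scheme.{u}} (sT : T ⟶ Spec (.of k)) (sB : B ⟶ Spec (.of k))
    [IsIntegral T] [IsSeparated sT] [LocallyOfFiniteType sT] [QuasiCompact sT]
    [IsIntegral B] [IsSeparated sB] [LocallyOfFiniteType sB] [QuasiCompact sB]
    (f : T ⟶ B) (hf : f ≫ sB = sT) [IsDominant f]
    (h_reg : FrobeniusFibration.IsRegular (f.fiber (genericPoint B)))
    (h_geom : GeometricallyIntegral (f.fiberToSpecResidueField (genericPoint B)))
    (h_dim : topologicalKrullDim (f.fiber (genericPoint B)) = 1)
    (n : ℕ)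
    (h_rat :
      haveI : CharP (B.residueField (genericPoint B)) p :=
        FrobeniusFibration.charP_residueField p sB (genericPoint B)
      Scheme.IsRationalOver (FrobeniusFibration.frobeniusPullback p n
        (f.fiberToSpecResidueField (genericPoint B)))) :
    FrobeniusFibration.IsInseparablyUniruled sT ∧
      (Scheme.IsRationalOver sB → FrobeniusFibration.IsInseparablyUnirational sT) := by
  have : CharP (B.residueField (genericPoint B)) p := charP_residueField p sB (genericPoint B)
  let η := genericPoint B
  let b := frobeniusPullback p n (f.fiberToSpecResidueField η)
  let c := pullback.fst (f.fiberToSpecResidueField η) (specFrobenius p n (B.residueField η))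
  obtain ⟨N, hN⟩ := h_rat.exists_birationalOver_affineSpace
  have hC : IsPullback (c ≫ f.fiberι η) b f
      (specFrobenius p n _ ≫ B.fromSpecResidueField η) :=
    (IsPullback.of_hasPullback (f.fiberToSpecResidueField η) _).paste_horiz
      (IsPullback.of_hasPullback f (B.fromSpecResidueField η))
  have hfs : IsSeparated f := by
    have : IsSeparated (f ≫ sB) := hf ▸ inferInstance
    exact .of_comp f sB
  have hft : LocallyOfFiniteType f := by
    have : LocallyOfFiniteType (f ≫ sB) := hf ▸ inferInstance
    exact locallyOfFiniteType_of_comp f sB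
  have hbs : IsSeparated b := MorphismProperty.of_isPullback hC hfs
  have hbt : LocallyOfFiniteType b := MorphismProperty.of_isPullback hC hft
  have : Surjective (specFrobenius p n (B.residueField η)) :=
    ⟨Function.surjective_to_subsingleton _⟩
  have hcs : Surjective c := inferInstance
  have := isDominant_fiberι_genericPoint f
  have hcd : IsDominant (c ≫ f.fiberι η) := inferInstance
  have hfin : Finite N := @finite_of_birationalOver_affineSpace (B.residueField η) _ _ b hbt N hN
  -- If `N` were empty, `C'` would be a point, and so would `C`, its image under `c`, contradicting
  -- dimension one.
  have hne : Nonempty N := by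
    by_contra! hempty
    have := subsingleton_of_birationalOver_affineSpace (Field.toIsField _) b hN
    have := hcs.surj.subsingleton
    have h0 := topologicalKrullDim_le_zero_of_subsingleton (f.fiber η)
    rw [h_dim] at h0
    exact absurd h0 (by decide)
  have := isIso_specFrobenius (k := k) p n
  refine ⟨?_, fun hB ↦ ?_⟩
  · classical
    obtain ⟨i₀⟩ := hne
    let N' := {i : N // i ≠ i₀}
    let ε : N ≃ N' ⊕ PUnit.{u + 1} :=
      (Equiv.optionSubtypeNe i₀).symm.trans (Equiv.optionEquivSumPUnit N')
    have := isIso_reindex ε B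
    -- The twisted structure; composing with an isomorphism keeps it separated and of finite type.
    let sY : 𝔸(N'; B) ⟶ Spec (.of k) := (𝔸(N'; B) ↘ B) ≫ sB ≫ specFrobenius p n (.of k)
    refine ⟨𝔸(N'; B), sY, inferInstance, inferInstance, inferInstance, inferInstance, ?_⟩
    refine purelyInseparablyDominates_of_birationalOver p n sT sB f hf hC N hN _ (𝟙 _)
      ((affineSpaceSumIso N' PUnit B).hom ≫ AffineSpace.reindex ε B) ?_
    simp only [Category.assoc, Category.id_comp, sY, AffineSpace.reindex_over_assoc]
    rw [← Category.assoc, affineSpaceSumIso_hom_over, Category.assoc]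
  · obtain ⟨m, hm⟩ := hB.exists_birationalOver_affineSpace
    have : Finite m := finite_of_birationalOver_affineSpace sB hm
    obtain ⟨π, hπ⟩ := hm
    have : Nonempty π.source.toScheme := π.dense_source.nonempty.to_subtype
    have := isOpenImmersion_affineSpaceMap N π.source.ι
    have := isOpenImmersion_affineSpaceMap N (π.iso.hom ≫ π.target.ι)
    -- Base change of the Frobenius of `k`: it absorbs the twist, leaving the standard structure on
    -- `𝔸(m ⊕ N; Spec k)`.
    have := isOpenImmersion_affineSpaceMap (m ⊕ N) (specFrobenius p n (.of k))
    have : Nonempty 𝔸(N; π.source) :=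
      (𝔸(N; π.source.toScheme) ↘ π.source.toScheme).surjective.nonempty
    refine ⟨m ⊕ N, inferInstance, ?_⟩
    refine purelyInseparablyDominates_of_birationalOver p n sT sB f hf hC N hN _
      (AffineSpace.map N (π.iso.hom ≫ π.target.ι) ≫ (affineSpaceSumIso m N _).hom ≫
        AffineSpace.map (m ⊕ N) (specFrobenius p n (.of k)))
      (AffineSpace.map N π.source.ι) ?_
    have hπ' : π.iso.hom ≫ π.target.ι ≫ (𝔸(m; Spec (.of k)) ↘ Spec (.of k)) =
      π.source.ι ≫ sB := hπ
    rw [AffineSpace.map_over_assoc]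
    simp only [Category.assoc]
    rw [AffineSpace.map_over, ← Category.assoc (affineSpaceSumIso m N _).hom,
      affineSpaceSumIso_hom_over, Category.assoc, AffineSpace.map_over_assoc, Category.assoc,
      ← Category.assoc π.target.ι, ← Category.assoc π.iso.hom, hπ', Category.assoc]
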